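/- Let $n\ge 2$ and $1\le r\le n-1$. Identify an $n$-bit word $x=(x_0,\dots,x_{n-1})\in\{0,1\}^n$ with the integer $x_0 2^{n-1}+x_1 2^{n-2}+\dots+x_{n-1}\in\{0,\dots,2^n-1\}$. Let $+$ denote addition modulo $2^n$, $\oplus$ bitwise addition modulo $2$, and $x\lll r=(x_r,\dots,x_{n-1},x_0,\dots,x_{r-1})$ the circular left shift by $r$ positions. For $n$-bit words $\alpha,\beta,\gamma$ let $$\mathrm{adp}_r(\alpha,\beta\to\gamma)=2^{-2n}\,\#\{(x,y)\in(\{0,1\}^n)^2:\ ((x+\alpha)\oplus(y+\beta))\lll r=((x\oplus y)\lll r)+\gamma\}$$ be the additive differential probability of the function $(x,y)\mapsto(x\oplus y)\lll r$, and let $N(n,r)$ be the number of its impossible differentials, i.e. the number of triples $(\alpha,\beta,\gamma)$ of $n$-bit words with $\mathrm{adp}_r(\alpha,\beta\to\gamma)=0$. Then: 1. $N(n,r)\le\left(\frac17+\frac1{2^{r+1}}\right)8^n-\frac17 8^r+\frac47\left(8^{r-1}-1\right)\left(\frac15 8^{n-r}+7\cdot 4^{n-r}-\frac{124}{5}3^{n-r-2}\right)$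 whenever $2\le r\le n-2$; 2. $N(n,n-1)\le\left(\frac9{28}+\frac1{2^n}\right)8^n-\frac{88}{7}$ for all $n\ge2$; 3. $N(n,r)\ge\frac17 8^n-\frac17 8^r$ for all $1\le r\le n-1$; 4. $N(n,1)=\frac5{14}8^n-\frac67$ for all $n\ge 2$. -/

import Mathlib

/-- The XR-operation `(x, y) ↦ (x ⊕ y) ⋘ r` on `n`-bit words: bitwise XOR followed by the
circular shift by `r` positions towards the most significant bit. -/
def xrOp (n r : ℕ) (x y : BitVec n) : BitVec n :=
  (x ^^^ y).rotateLeft r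

/-- The additive differential probability `adp^f(α, β → γ)` of a function `f` of two `n`-bit words:
`2^(-2n)` times the number of pairs `(x, y)` with `f (x + α, y + β) = f (x, y) + γ`, where the
addition is modulo `2 ^ n`. -/
noncomputable def adp {n : ℕ} (f : BitVec n → BitVec n → BitVec n) (α β γ : BitVec n) : ℚ :=
  (Nat.card {p : BitVec n × BitVec n // f (p.1 + α) (p.2 + β) = f p.1 p.2 + γ} : ℚ)
    / 2 ^ (2 * n)

/-- The additive differential probability of the XR-operation. -/
noncomputable def adpXR (n r : ℕ) (α β γ : BitVec n) : ℚ :=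
  adp (xrOp n r) α β γ

/-- `N(n, r)`: the number of impossible differentials of the XR-operation, i.e. of the triples
`(α, β, γ)` of `n`-bit words for which the additive differential probability is zero. -/
noncomputable def numImpossibleXR (n r : ℕ) : ℕ :=
  Nat.card {d : BitVec n × BitVec n × BitVec n // adpXR n r d.1 d.2.1 d.2.2 = 0}

/-!
The differential `(α, β) → γ` of the XR-operation is possible iff some run of a finite automaton
accepts it. The automaton reads the bits of `(α, β, γ)` from the least significant end, and its
state is the triple of carries in the additions `x + α`, `y + β` and `((x ⊕ y) ⋘ r) + γ`. With
`n = m + r`, the rotation exchanges the low `m` and the high `r` bits of `x ⊕ y`. Hence the third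
addition starts, with carry `0`, at the high part of `x` and `y`, and its carry `c` at the end of
the high part is the third carry at the beginning of the low part. So the differential is possible
iff for some guess `c` a path starts at `(0, 0, c)`, reads the low word, has its third coordinate
reset to `0`, reads the high word, and ends with third coordinate `c` (`exists_xrOp_iff`). The
parity of the first letter determines the guess (`Reaches.parity_eq`), so that the possible
differentials are counted by adding the two guesses.

From one carry triple `s` and one letter `w` the automaton stops if the parities of `s` and `w`
differ, stays at `s` if `w = s`, and otherwise frees the two coordinates in which `s` and `w`
differ. The sets of carries reachable along words therefore stay within a short list: the empty set,
vertices, faces, unions of two adjacent faces and complements of vertices of the cube, and, at the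
start of the high word, parts of the face `c = 0`. These sets fall into few classes such that the
number of letters leading from a set into a class depends only on the class of the set
(`card_lowClass`, `card_highClass`). Counting words is thereby reduced to powers of two small
transfer matrices (`sum_run`). The relevant entries have closed forms (`lowTrans_pow`,
`highCount_closed`), which give an exact formula for the number of impossible differentials
(`numImpossibleXR_closed`). The four assertions are read off from that formula.
-/

/-! ### The carry automaton -/

/-- A vertex of the cube `{0, 1}³`. It serves both as the triple of current carries of the three
additions by `α`, `β` and `γ`, and as a letter of the automaton: a triple of bits of `α`, `β`, `γ`.
-/
abbrev Carry := Bool × Bool × Bool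

namespace Carry

/-- The sum of the three coordinates modulo `2`. -/
def parity (s : Carry) : Bool := s.1 ^^ s.2.1 ^^ s.2.2

/-- The carry triples that can follow `s` when the letter `w` is read. The pair `p` runs over the
two bits of `x` and `y`. The parity condition says that the result bits satisfy the differential
equation; it does not depend on `p`. -/
def next (w s : Carry) : Finset Carry :=
  if parity w = parity s then
    Finset.univ.image fun p : Bool × Bool =>
      (Bool.atLeastTwo p.1 w.1 s.1, Bool.atLeastTwo p.2 w.2.1 s.2.1,
        Bool.atLeastTwo (p.1 ^^ p.2) w.2.2 s.2.2)
  else ∅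

/-- The carry triples that can follow some element of `S` when `w` is read. -/
def step (w : Carry) (S : Finset Carry) : Finset Carry := S.biUnion (next w)

/-- Reset the third carry to `0`: between the low and the high word, the addition by `γ` ends and
starts anew. -/
def lift (S : Finset Carry) : Finset Carry := S.image fun t => (t.1, t.2.1, false)

/-- A family of sets of carries closed under `step`: the empty set, the vertices, the faces, the
unions of two adjacent faces, and the complements of vertices. -/
def lowFamily : Finset (Finset Carry) :=
  {∅} ∪ Finset.univ.image (fun s => {s}) ∪
  Finset.univ.image (fun v : Bool => Finset.univ.filter fun t => t.1 = v) ∪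
  Finset.univ.image (fun v : Bool => Finset.univ.filter fun t => t.2.1 = v) ∪
  Finset.univ.image (fun v : Bool => Finset.univ.filter fun t => t.2.2 = v) ∪
  Finset.univ.image (fun s : Carry => Finset.univ.filter fun t => t.1 = s.1 ∨ t.2.1 = s.2.1) ∪
  Finset.univ.image (fun s : Carry => Finset.univ.filter fun t => t.1 = s.1 ∨ t.2.2 = s.2.2) ∪
  Finset.univ.image (fun s : Carry => Finset.univ.filter fun t => t.2.1 = s.2.1 ∨ t.2.2 = s.2.2) ∪
  Finset.univ.image (fun s : Carry => Finset.univ.filter fun t => t ≠ s)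

/-- A family of sets of carries closed under `step` that contains `lift S` for `S` in `lowFamily`.
Beyond `lowFamily` it has the edges, and the faces without a vertex, in the two faces on which the
third coordinate is constant. -/
def highFamily : Finset (Finset Carry) :=
  lowFamily ∪
  Finset.univ.image (fun s : Carry => Finset.univ.filter fun t => t.2.2 = s.2.2 ∧ t.1 = s.1) ∪
  Finset.univ.image (fun s : Carry => Finset.univ.filter fun t => t.2.2 = s.2.2 ∧ t.2.1 = s.2.1) ∪
  Finset.univ.image (fun s : Carry => Finset.univ.filter fun t => t.2.2 = s.2.2 ∧ t ≠ s)

/-- The class of a member of `lowFamily`: empty (`0`), vertex (`1`), face with two (`2`) or four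
(`3`) points in its projection to the first two coordinates, union of two faces with three (`4`) or
four (`5`) points in that projection, complement of a vertex (`6`). -/
def lowClass (S : Finset Carry) : Fin 7 :=
  if S.card = 0 then 0 else if S.card = 1 then 1
  else if S.card = 4 then (if (lift S).card = 2 then 2 else 3)
  else if S.card = 6 then (if (lift S).card = 3 then 4 else 5) else 6

/-- `lowTrans i j` is the number of letters that lead from a set of class `i` to class `j`. -/
def lowTrans : Matrix (Fin 7) (Fin 7) ℕ :=
  !![8,0,0,0,0,0,0;
     4,1,2,1,0,0,0;
     0,0,4,0,0,4,0;
     0,0,0,4,4,0,0;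
     0,0,0,0,2,4,2;
     0,0,0,0,2,4,2;
     0,0,0,0,1,2,5]

/-- The class of a member of `highFamily`, relative to a wanted final value `c` of the third
coordinate: the empty set (`0`), and then in pairs the sets of at least four elements (`1`, `2`),
the vertices (`3`, `4`), the edges (`5`, `6`) and the sets of three elements (`7`, `8`). In each
pair the odd number is for the sets in which the value `c` occurs. -/
def highClass (c : Bool) (S : Finset Carry) : Fin 9 :=
  if S.card = 0 then 0
  else if ∃ t ∈ S, t.2.2 = c then
    (if S.card = 1 then 3 else if S.card = 2 then 5 else if S.card = 3 then 7 else 1)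
  else
    (if S.card = 1 then 4 else if S.card = 2 then 6 else if S.card = 3 then 8 else 2)

/-- `highTrans i j` is the number of letters that lead from a set of class `i` to class `j`. -/
def highTrans : Matrix (Fin 9) (Fin 9) ℕ :=
  !![8,0,0,0,0,0,0,0,0;
     0,8,0,0,0,0,0,0,0;
     0,4,4,0,0,0,0,0,0;
     4,3,0,1,0,0,0,0,0;
     4,2,1,0,1,0,0,0,0;
     0,6,0,2,0,0,0,0,0;
     0,4,2,0,2,0,0,0,0;
     0,7,0,1,0,0,0,0,0;
     0,4,3,0,1,0,0,0,0]

/-! ### Lumping of the reachable sets into classes -/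

theorem step_lowFamily : ∀ S ∈ lowFamily, ∀ w, step w S ∈ lowFamily := by
  decide +kernel

theorem step_highFamily : ∀ S ∈ highFamily, ∀ w, step w S ∈ highFamily := by
  decide +kernel

theorem card_lowClass : ∀ S ∈ lowFamily, ∀ j,
    (Finset.univ.filter fun w => lowClass (step w S) = j).card = lowTrans (lowClass S) j := by
  decide +kernel

theorem card_highClass : ∀ c, ∀ S ∈ highFamily, ∀ j,
    (Finset.univ.filter fun w => highClass c (step w S) = j).card =
      highTrans (highClass c S) j := by
  decide +kernel

/-! ### Words and paths -/

/-- The set of carries reachable from `S` along the word `w`, first letter first. -/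
def run : ∀ {k : ℕ}, (Fin k → Carry) → Finset Carry → Finset Carry
  | 0, _, S => S
  | _ + 1, w, S => run (Fin.tail w) (step (w 0) S)

theorem mem_next {w s t : Carry} : t ∈ next w s ↔ parity w = parity s ∧ ∃ x y : Bool,
    t = (Bool.atLeastTwo x w.1 s.1, Bool.atLeastTwo y w.2.1 s.2.1,
      Bool.atLeastTwo (x ^^ y) w.2.2 s.2.2) := by
  unfold next
  split_ifs with h
  · simp [h, eq_comm]
  · simp [h]

theorem mem_run {k : ℕ} (w : Fin k → Carry) (S : Finset Carry) (t : Carry) :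
    t ∈ run w S ↔ ∃ p : ℕ → Carry, p 0 ∈ S ∧ p k = t ∧
      ∀ i (h : i < k), p (i + 1) ∈ next (w ⟨i, h⟩) (p i) := by
  induction k generalizing S with
  | zero =>
    exact ⟨fun h => ⟨fun _ => t, h, rfl, fun i hi => absurd hi (by omega)⟩,
      fun ⟨p, h, ht, _⟩ => ht ▸ h⟩
  | succ k ih =>
    rw [run, ih]
    constructor
    · rintro ⟨p, hp, hk, hn⟩
      obtain ⟨s, hs, hps⟩ := Finset.mem_biUnion.1 hp
      refine ⟨fun i => Nat.casesOn i s p, hs, hk, fun i hi => ?_⟩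
      cases i with
      | zero => exact hps
      | succ i => exact hn i (by omega)
    · rintro ⟨p, hp, hk, hn⟩
      exact ⟨fun i => p (i + 1), Finset.mem_biUnion.2 ⟨p 0, hp, hn 0 (by omega)⟩, hk,
        fun i hi => hn (i + 1) (by omega)⟩

variable {m r : ℕ}

/-! ### Differentials as pairs of words -/

/-- The letters of a differential for the low `m` bits of `x` and `y`, least significant bit first.
After the rotation these bits meet the bits of `γ` from position `r` on. -/
def lowWord (d : BitVec (m + r) × BitVec (m + r) × BitVec (m + r)) (j : Fin m) : Carry :=
  (d.1.getLsbD j, d.2.1.getLsbD j, d.2.2.getLsbD (r + j))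

/-- The letters of a differential for the high `r` bits of `x` and `y`, least significant bit first.
After the rotation these bits meet the low `r` bits of `γ`. -/
def highWord (d : BitVec (m + r) × BitVec (m + r) × BitVec (m + r)) (j : Fin r) : Carry :=
  (d.1.getLsbD (m + j), d.2.1.getLsbD (m + j), d.2.2.getLsbD j)

theorem card_bitVec (k : ℕ) : Fintype.card (BitVec k) = 2 ^ k :=
  (Fintype.card_congr ⟨BitVec.toFin, BitVec.ofFin, fun _ => rfl, fun _ => rfl⟩).trans
    (Fintype.card_fin _)

theorem words_bijective : Function.Bijective
    fun d : BitVec (m + r) × BitVec (m + r) × BitVec (m + r) => (lowWord d, highWord d) := by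
  rw [Fintype.bijective_iff_injective_and_card]
  constructor
  · rintro ⟨a, b, c⟩ ⟨a', b', c'⟩ h
    simp only [Prod.mk.injEq, funext_iff, lowWord, highWord] at h
    obtain ⟨hl, hh⟩ := h
    refine Prod.ext ?_ (Prod.ext ?_ ?_)
    all_goals
      refine BitVec.eq_of_getLsbD_eq fun i hi => ?_
      dsimp only
    · by_cases him : i < m
      · exact (hl ⟨i, him⟩).1
      · simpa [Nat.add_sub_cancel' (not_lt.1 him)] using (hh ⟨i - m, by omega⟩).1
    · by_cases him : i < m
      · exact (hl ⟨i, him⟩).2.1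
      · simpa [Nat.add_sub_cancel' (not_lt.1 him)] using (hh ⟨i - m, by omega⟩).2.1
    · by_cases hir : i < r
      · exact (hh ⟨i, hir⟩).2.2
      · simpa [Nat.add_sub_cancel' (not_lt.1 hir)] using (hl ⟨i - r, by omega⟩).2.2
  · simp only [Fintype.card_prod, Fintype.card_fun, card_bitVec, Fintype.card_bool,
      Fintype.card_fin, pow_add, mul_pow]
    ring

theorem getLsbD_rotate_high (hm : 0 < m) (z : BitVec (m + r)) {i : ℕ} (hi : i < r) :
    (z.rotateLeft r).getLsbD i = z.getLsbD (m + i) := by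
  rw [BitVec.getLsbD_rotateLeft_of_le (Nat.lt_add_of_pos_left hm)]
  simp [hi]

theorem getLsbD_rotate_low (z : BitVec (m + r)) {i : ℕ} (hi : i < m) :
    (z.rotateLeft r).getLsbD (r + i) = z.getLsbD i := by
  rw [BitVec.getLsbD_rotateLeft_of_le (by omega)]
  simp [show r + i < m + r by omega]

/-- Comparing bits, the differential equation is a parity condition on carries and letters at every
position. -/
theorem xrOp_add_iff (hm : 0 < m) (d : BitVec (m + r) × BitVec (m + r) × BitVec (m + r))
    (x y : BitVec (m + r)) :
    xrOp (m + r) r (x + d.1) (y + d.2.1) = xrOp (m + r) r x y + d.2.2 ↔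
      (∀ j : Fin m, parity (lowWord d j) =
        parity (BitVec.carry j x d.1 false, BitVec.carry j y d.2.1 false,
          BitVec.carry (r + j) (xrOp (m + r) r x y) d.2.2 false)) ∧
      ∀ j : Fin r, parity (highWord d j) =
        parity (BitVec.carry (m + j) x d.1 false, BitVec.carry (m + j) y d.2.1 false,
          BitVec.carry j (xrOp (m + r) r x y) d.2.2 false) := by
  have key : ∀ a b x y a' b' z c : Bool,
      ((x ^^ (a ^^ a')) ^^ (y ^^ (b ^^ b'))) = ((x ^^ y) ^^ (z ^^ c)) ↔
        parity (a, b, z) = parity (a', b', c) := by unfold parity; decide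
  constructor
  · intro h
    have h' := fun i => congrArg (BitVec.getLsbD · i) h
    refine ⟨fun j => ?_, fun j => ?_⟩
    · have := h' (r + j)
      rw [BitVec.getLsbD_add (by omega)] at this
      simp only [xrOp, getLsbD_rotate_low _ j.2, BitVec.getLsbD_xor] at this
      rw [BitVec.getLsbD_add (by omega), BitVec.getLsbD_add (by omega)] at this
      exact (key _ _ _ _ _ _ _ _).1 this
    · have := h' j
      rw [BitVec.getLsbD_add (by omega)] at this
      simp only [xrOp, getLsbD_rotate_high hm _ j.2, BitVec.getLsbD_xor] at this
      rw [BitVec.getLsbD_add (by omega), BitVec.getLsbD_add (by omega)] at this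
      exact (key _ _ _ _ _ _ _ _).1 this
  · rintro ⟨hl, hh⟩
    refine BitVec.eq_of_getLsbD_eq fun i hi => ?_
    rw [BitVec.getLsbD_add hi]
    by_cases hir : i < r
    · simp only [xrOp, getLsbD_rotate_high hm _ hir, BitVec.getLsbD_xor]
      rw [BitVec.getLsbD_add (by omega), BitVec.getLsbD_add (by omega)]
      exact (key _ _ _ _ _ _ _ _).2 (hh ⟨i, hir⟩)
    · obtain ⟨j, rfl⟩ := Nat.exists_eq_add_of_le (not_lt.1 hir)
      have hj : j < m := by omega
      simp only [xrOp, getLsbD_rotate_low _ hj, BitVec.getLsbD_xor]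
      rw [BitVec.getLsbD_add (by omega), BitVec.getLsbD_add (by omega)]
      exact (key _ _ _ _ _ _ _ _).2 (hl ⟨j, hj⟩)

/-- The pair of a low word `u` and a high word `v` is passed with the guess `c` for the third carry
at the start of the low word: this guess has to be the third carry at the end of the high word. -/
def Reaches (c : Bool) (u : Fin m → Carry) (v : Fin r → Carry) : Prop :=
  ∃ t ∈ run v (lift (run u {(false, false, c)})), t.2.2 = c

theorem mem_lift {S : Finset Carry} {t : Carry} :
    t ∈ lift S ↔ t.2.2 = false ∧ ∃ c, (t.1, t.2.1, c) ∈ S := by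
  obtain ⟨a, b, c⟩ := t
  simp only [lift, Finset.mem_image, Prod.exists, Prod.mk.injEq]
  constructor
  · rintro ⟨a', b', c', h, rfl, rfl, rfl⟩
    exact ⟨rfl, c', h⟩
  · rintro ⟨rfl, c', h⟩
    exact ⟨a, b, c', h, rfl, rfl, rfl⟩

theorem exists_bits (k : ℕ) (f : ℕ → Bool) : ∃ x : BitVec k, ∀ i < k, x.getLsbD i = f i :=
  ⟨BitVec.ofFnLE fun i => f i, fun i hi => by simp [hi]⟩

/-- A differential is possible iff its words are passed with some guess. From `x` and `y`, the path
is the sequence of carries; conversely the bits of `x` and `y` are those chosen along the path. -/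
theorem exists_xrOp_iff (hm : 0 < m) (d : BitVec (m + r) × BitVec (m + r) × BitVec (m + r)) :
    (∃ x y, xrOp (m + r) r (x + d.1) (y + d.2.1) = xrOp (m + r) r x y + d.2.2) ↔
      ∃ c, Reaches c (lowWord d) (highWord d) := by
  constructor
  · rintro ⟨x, y, h⟩
    obtain ⟨hl, hh⟩ := (xrOp_add_iff hm d x y).1 h
    set z := xrOp (m + r) r x y with hz
    refine ⟨BitVec.carry r z d.2.2 false,
      (BitVec.carry (m + r) x d.1 false, BitVec.carry (m + r) y d.2.1 false,
        BitVec.carry r z d.2.2 false), ?_, rfl⟩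
    rw [mem_run]
    refine ⟨fun i => (BitVec.carry (m + i) x d.1 false, BitVec.carry (m + i) y d.2.1 false,
        BitVec.carry i z d.2.2 false), ?_, rfl, fun i hi => ?_⟩
    · refine mem_lift.2 ⟨by simp, BitVec.carry (r + m) z d.2.2 false, ?_⟩
      rw [mem_run]
      refine ⟨fun i => (BitVec.carry i x d.1 false, BitVec.carry i y d.2.1 false,
        BitVec.carry (r + i) z d.2.2 false), by simp, rfl, fun i hi => ?_⟩
      refine mem_next.2 ⟨hl ⟨i, hi⟩, x.getLsbD i, y.getLsbD i, ?_⟩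
      simp only [← add_assoc, BitVec.carry_succ, lowWord]
      rw [hz, xrOp, getLsbD_rotate_low _ hi, BitVec.getLsbD_xor]
    · refine mem_next.2 ⟨hh ⟨i, hi⟩, x.getLsbD (m + i), y.getLsbD (m + i), ?_⟩
      simp only [← add_assoc, BitVec.carry_succ, highWord]
      rw [hz, xrOp, getLsbD_rotate_high hm _ hi, BitVec.getLsbD_xor]
  · rintro ⟨c, t, ht, htc⟩
    obtain ⟨q, hq0, hqr, hq⟩ := (mem_run _ _ _).1 ht
    obtain ⟨hq2, c', hc'⟩ := mem_lift.1 hq0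
    obtain ⟨p, hp0, hpm, hp⟩ := (mem_run _ _ _).1 hc'
    simp only [mem_next] at hp hq
    rw [Finset.mem_singleton] at hp0
    choose hpp xl yl hpn using hp
    choose hqp xh yh hqn using hq
    obtain ⟨x, hx⟩ := exists_bits (m + r) fun i =>
      if h : i < m then xl i h else if h : i - m < r then xh (i - m) h else false
    obtain ⟨y, hy⟩ := exists_bits (m + r) fun i =>
      if h : i < m then yl i h else if h : i - m < r then yh (i - m) h else false
    have hxl : ∀ i (h : i < m), x.getLsbD i = xl i h := fun i h => by
      rw [hx i (by omega), dif_pos h]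
    have hyl : ∀ i (h : i < m), y.getLsbD i = yl i h := fun i h => by
      rw [hy i (by omega), dif_pos h]
    have hxh : ∀ i (h : i < r), x.getLsbD (m + i) = xh i h := fun i h => by
      rw [hx _ (by omega), dif_neg (by omega), dif_pos (by omega)]
      simp only [Nat.add_sub_cancel_left]
    have hyh : ∀ i (h : i < r), y.getLsbD (m + i) = yh i h := fun i h => by
      rw [hy _ (by omega), dif_neg (by omega), dif_pos (by omega)]
      simp only [Nat.add_sub_cancel_left]
    set z := xrOp (m + r) r x y with hz
    -- The carries of the two low halves agree with the path through the low word.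
    have hab : ∀ i ≤ m, BitVec.carry i x d.1 false = (p i).1 ∧
        BitVec.carry i y d.2.1 false = (p i).2.1 := by
      intro i
      induction i with
      | zero => simp [hp0]
      | succ i ih =>
        intro hi
        rw [BitVec.carry_succ, BitVec.carry_succ, (ih (by omega)).1, (ih (by omega)).2,
          hpn i hi, hxl i hi, hyl i hi]
        exact ⟨rfl, rfl⟩
    -- The third addition starts at the high word with carry `0`, as the path does after the reset.
    have hhigh : ∀ i ≤ r, (BitVec.carry (m + i) x d.1 false, BitVec.carry (m + i) y d.2.1 false,
        BitVec.carry i z d.2.2 false) = q i := by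
      intro i
      induction i with
      | zero =>
        intro _
        ext
        · simpa [hpm] using (hab m le_rfl).1
        · simpa [hpm] using (hab m le_rfl).2
        · simp [hq2]
      | succ i ih =>
        intro hi
        rw [hqn i hi, ← ih (by omega), ← add_assoc, BitVec.carry_succ, BitVec.carry_succ,
          BitVec.carry_succ, hxh i hi, hyh i hi, hz, xrOp, getLsbD_rotate_high hm _ hi,
          BitVec.getLsbD_xor, hxh i hi, hyh i hi]
        rfl
    have hc : BitVec.carry r z d.2.2 false = c := by
      have := congrArg (fun s => s.2.2) (hhigh r le_rfl)
      rwa [hqr, htc] at this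
    -- Hence the guess `c` is the third carry with which the low word starts.
    have hlow : ∀ i ≤ m, (BitVec.carry i x d.1 false, BitVec.carry i y d.2.1 false,
        BitVec.carry (r + i) z d.2.2 false) = p i := by
      intro i
      induction i with
      | zero => simp [hp0, hc]
      | succ i ih =>
        intro hi
        rw [hpn i hi, ← ih (by omega), ← add_assoc, BitVec.carry_succ, BitVec.carry_succ,
          BitVec.carry_succ, hxl i hi, hyl i hi, hz, xrOp, getLsbD_rotate_low _ hi,
          BitVec.getLsbD_xor, hxl i hi, hyl i hi]
        rfl
    refine ⟨x, y, (xrOp_add_iff hm d x y).2 ⟨fun j => ?_, fun j => ?_⟩⟩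
    · rw [← hz, hlow j j.2.le]
      exact hpp j j.2
    · rw [← hz, hhigh j j.2.le]
      exact hqp j j.2

/-- At most one guess succeeds, as it is determined by the lowest bits. -/
theorem Reaches.parity_eq (hm : 0 < m) {c : Bool} {u : Fin m → Carry} {v : Fin r → Carry}
    (h : Reaches c u v) : parity (u ⟨0, hm⟩) = c := by
  obtain ⟨t, ht, -⟩ := h
  obtain ⟨q, hq0, -, -⟩ := (mem_run _ _ _).1 ht
  obtain ⟨-, c', hc'⟩ := mem_lift.1 hq0
  obtain ⟨p, hp0, -, hp⟩ := (mem_run _ _ _).1 hc'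
  rw [(mem_next.1 (hp 0 hm)).1, Finset.mem_singleton.1 hp0]
  simp [parity]

/-! ### Counting words by transfer matrices -/

/-- If the number of letters from a set into a class depends only on the class of the set, then
words are counted by powers of the matrix of these numbers. -/
theorem sum_run {κ : Type*} [Fintype κ] [DecidableEq κ] {cls : Finset Carry → κ}
    {F : Finset (Finset Carry)} {T : Matrix κ κ ℕ}
    (hF : ∀ S ∈ F, ∀ w, step w S ∈ F)
    (hT : ∀ S ∈ F, ∀ j, (Finset.univ.filter fun w => cls (step w S) = j).card = T (cls S) j)
    (ψ : κ → ℚ) (k : ℕ) {S : Finset Carry} (hS : S ∈ F) :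
    ∑ w : Fin k → Carry, ψ (cls (run w S)) =
      ∑ j, (T.map (Nat.cast : ℕ → ℚ) ^ k) (cls S) j * ψ j := by
  induction k generalizing S with
  | zero => simp [run, Matrix.one_apply]
  | succ k ih =>
    rw [← (Fin.consEquiv fun _ => Carry).sum_comp, Fintype.sum_prod_type]
    have h1 : ∀ (a : Carry) (w : Fin k → Carry),
        run ((Fin.consEquiv fun _ => Carry) (a, w)) S = run w (step a S) := fun a w => by
      simp [run, Fin.consEquiv]
    simp only [h1]
    rw [Finset.sum_congr rfl fun a _ => ih (hF S hS a),
      ← Finset.sum_fiberwise (g := fun a => cls (step a S))]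
    have h2 : ∀ i, ∑ a with cls (step a S) = i,
        ∑ j, (T.map (Nat.cast : ℕ → ℚ) ^ k) (cls (step a S)) j * ψ j =
        T (cls S) i * ∑ j, (T.map (Nat.cast : ℕ → ℚ) ^ k) i j * ψ j := fun i => by
      rw [Finset.sum_congr rfl (g := fun _ => ∑ j, (T.map (Nat.cast : ℕ → ℚ) ^ k) i j * ψ j)
        fun a ha => by rw [(Finset.mem_filter.1 ha).2], Finset.sum_const, hT S hS, nsmul_eq_mul]
    simp only [h2, pow_succ', Matrix.mul_apply, Finset.sum_mul, Finset.mul_sum,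
      Matrix.map_apply, mul_assoc]
    exact Finset.sum_comm

/-- Closed form of the number of words of length `m` that lead from a vertex to a union of two
faces whose projection to the first two coordinates has three points. -/
def threeCount (m : ℕ) : ℚ := 3 / 35 * 8 ^ m + 4 ^ m / 3 + 8 / 21 - 4 / 5 * 3 ^ m

/-- Closed form of the number of words of length `s + 1` that lead from exactly one of the four
vertices with third coordinate `0`, a prescribed one, to a nonempty set, and from it to a set in
which both values of the third coordinate occur. -/
def survivorCount (s : ℕ) : ℚ := 4 / 7 * 8 ^ s - 2 / 3 * 4 ^ s + 2 / 21

/-- The number of words of length `m` that lead from a vertex into each of the classes. -/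
theorem lowTrans_pow (m : ℕ) :
    (lowTrans.map (Nat.cast : ℕ → ℚ) ^ m) 1 =
      ![(4 * 8 ^ m - 4) / 7, 1, 2 * ((4 ^ m - 1) / 3), (4 ^ m - 1) / 3,
        threeCount m, 2 * threeCount m,
        (3 * 8 ^ m - 7 * 4 ^ m + 4) / 7 - 3 * threeCount m] := by
  induction m with
  | zero =>
    ext j
    fin_cases j <;> norm_num [Matrix.one_apply, threeCount]
  | succ m ih =>
    ext j
    rw [pow_succ, Matrix.mul_apply, Fin.sum_univ_seven, ih]
    fin_cases j <;> simp [lowTrans, threeCount] <;> ring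

/-- The indicator of the classes in which the wanted value of the third coordinate occurs. -/
def highReach : Fin 9 → ℚ := ![0, 1, 0, 1, 0, 1, 0, 1, 0]

/-- The number of words of length `r` that lead from a set of class `i` to a set in which the wanted
value of the third coordinate occurs. -/
def highCount (r : ℕ) (i : Fin 9) : ℚ :=
  ∑ j, (highTrans.map (Nat.cast : ℕ → ℚ) ^ r) i j * highReach j

theorem highCount_succ (r : ℕ) (i : Fin 9) :
    highCount (r + 1) i = ∑ j, highTrans i j * highCount r j := by
  simp only [highCount, pow_succ', Matrix.mul_apply, Finset.sum_mul, Finset.mul_sum,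
    Matrix.map_apply, mul_assoc]
  exact Finset.sum_comm

theorem highCount_zero (i : Fin 9) : highCount 0 i = highReach i := by
  simp [highCount, Matrix.one_apply]

/-- The classes `0` to `4` are closed under transitions. The remaining classes move into them with
the first letter, so `highCount_succ` evaluates `highCount` there as well. -/
theorem highCount_closed (r : ℕ) :
    highCount r 0 = 0 ∧ highCount r 1 = 8 ^ r ∧ highCount r 2 = 8 ^ r - 4 ^ r ∧
      highCount r 3 = (3 * 8 ^ r + 4) / 7 ∧ highCount r 4 = 3 / 7 * 8 ^ r - 4 ^ r / 3 - 2 / 21 := by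
  induction r with
  | zero =>
    simp only [highCount_zero]
    have e2 : highReach 2 = 0 := rfl
    have e3 : highReach 3 = 1 := rfl
    have e4 : highReach 4 = 0 := rfl
    exact ⟨rfl, rfl, by norm_num [e2], by norm_num [e3], by norm_num [e4]⟩
  | succ r ih =>
    obtain ⟨h0, h1, h2, h3, h4⟩ := ih
    refine ⟨?_, ?_, ?_, ?_, ?_⟩ <;>
      simp [highCount_succ, highTrans, Fin.sum_univ_succ, h0, h1, h2, h3, h4] <;> ring

instance (c : Bool) (u : Fin m → Carry) (v : Fin r → Carry) : Decidable (Reaches c u v) :=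
  inferInstanceAs (Decidable (∃ t ∈ run v (lift (run u {(false, false, c)})), t.2.2 = c))

theorem highReach_highClass (c : Bool) (S : Finset Carry) :
    highReach (highClass c S) = if ∃ t ∈ S, t.2.2 = c then 1 else 0 := by
  by_cases h : ∃ t ∈ S, t.2.2 = c
  · have h0 : S.card ≠ 0 := fun h0 => by simp [Finset.card_eq_zero.1 h0] at h
    rw [highClass, if_neg h0, if_pos h, if_pos h]
    split_ifs <;> rfl
  · rw [highClass, if_neg h, if_neg h]
    split_ifs <;> rfl

/-- The class relative to `c` of `lift S`, in terms of the class of `S`. -/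
def liftClass : Bool → Fin 7 → Fin 9
  | false => ![0, 3, 5, 1, 7, 1, 1]
  | true => ![0, 4, 6, 2, 8, 2, 2]

theorem lift_mem_highFamily : ∀ S ∈ lowFamily, lift S ∈ highFamily := by
  decide +kernel

theorem highClass_lift : ∀ c, ∀ S ∈ lowFamily, highClass c (lift S) = liftClass c (lowClass S) := by
  decide +kernel

theorem run_mem_of_step_mem {F : Finset (Finset Carry)} (hF : ∀ S ∈ F, ∀ w, step w S ∈ F) {k : ℕ}
    (w : Fin k → Carry) {S : Finset Carry} (hS : S ∈ F) : run w S ∈ F := by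
  induction k generalizing S with
  | zero => exact hS
  | succ k ih => exact ih _ (hF S hS _)

theorem vertex_mem_lowFamily : ∀ c : Bool, {(false, false, c)} ∈ lowFamily := by
  decide +kernel

theorem lowClass_vertex : ∀ c : Bool, lowClass {(false, false, c)} = 1 := by
  decide +kernel

theorem sum_reaches (m r : ℕ) (c : Bool) :
    ∑ u : Fin m → Carry, ∑ v : Fin r → Carry, (if Reaches c u v then (1 : ℚ) else 0) =
      ∑ j, (lowTrans.map (Nat.cast : ℕ → ℚ) ^ m) 1 j * highCount r (liftClass c j) := by
  have h : ∀ u : Fin m → Carry, ∑ v : Fin r → Carry, (if Reaches c u v then (1 : ℚ) else 0) =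
      highCount r (liftClass c (lowClass (run u {(false, false, c)}))) := fun u => by
    have hu := run_mem_of_step_mem step_lowFamily u (vertex_mem_lowFamily c)
    rw [← highClass_lift c _ hu, highCount, ← sum_run step_highFamily (card_highClass c) _ _
      (lift_mem_highFamily _ hu)]
    simp only [highReach_highClass]
    rfl
  rw [Finset.sum_congr rfl fun u _ => h u,
    sum_run step_lowFamily card_lowClass (fun j => highCount r (liftClass c j)) m
      (vertex_mem_lowFamily c),
    lowClass_vertex]

theorem adp_eq_zero_iff {n : ℕ} (f : BitVec n → BitVec n → BitVec n) (α β γ : BitVec n) :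
    adp f α β γ = 0 ↔ ¬∃ x y, f (x + α) (y + β) = f x y + γ := by
  have : Finite {p : BitVec n × BitVec n // f (p.1 + α) (p.2 + β) = f p.1 p.2 + γ} := inferInstance
  rw [adp, div_eq_zero_iff, or_iff_left (by positivity), Nat.cast_eq_zero, Finite.card_eq_zero_iff,
    isEmpty_subtype]
  simp

/-! ### The number of impossible differentials -/

theorem numImpossibleXR_eq (hm : 0 < m) :
    (numImpossibleXR (m + r) r : ℚ) = 8 ^ m * 8 ^ r - ∑ c : Bool,
      ∑ j, (lowTrans.map (Nat.cast : ℕ → ℚ) ^ m) 1 j * highCount r (liftClass c j) := by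
  have h1 : numImpossibleXR (m + r) r =
      Fintype.card {p : (Fin m → Carry) × (Fin r → Carry) // ¬∃ c, Reaches c p.1 p.2} := by
    rw [numImpossibleXR, ← Nat.card_eq_fintype_card]
    refine Nat.card_congr ((Equiv.ofBijective _ words_bijective).subtypeEquiv fun d => ?_)
    rw [adpXR, adp_eq_zero_iff, exists_xrOp_iff hm d]
    rfl
  have h2 : ∀ (u : Fin m → Carry) (v : Fin r → Carry),
      (if ¬∃ c, Reaches c u v then (1 : ℚ) else 0) =
        1 - ∑ c : Bool, if Reaches c u v then (1 : ℚ) else 0 := fun u v => by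
    have h : ¬(Reaches true u v ∧ Reaches false u v) := fun h =>
      Bool.noConfusion ((h.1.parity_eq hm).symm.trans (h.2.parity_eq hm))
    by_cases ht : Reaches true u v <;> by_cases hf : Reaches false u v <;>
      simp_all [-Finset.sum_boole]
  rw [h1, Fintype.card_subtype, Finset.card_filter, Nat.cast_sum, Fintype.sum_prod_type]
  simp only [Nat.cast_ite, Nat.cast_one, Nat.cast_zero, h2, Finset.sum_sub_distrib]
  congr 1
  · rw [Finset.sum_const, Finset.sum_const, Finset.card_univ, Finset.card_univ]
    simp only [Fintype.card_fun, Fintype.card_prod, Fintype.card_bool, Fintype.card_fin]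
    push_cast
    norm_num
  · simp only [← sum_reaches, Fintype.sum_bool, Finset.sum_add_distrib]

/-- The exact number of impossible differentials, with `m` low and `s + 1` high bits. -/
theorem numImpossibleXR_closed (hm : 0 < m) (s : ℕ) :
    (numImpossibleXR (m + (s + 1)) (s + 1) : ℚ) =
      8 ^ (s + 1) * (8 ^ m - 8) / 7 + 4 / 7 * (8 ^ (s + 1) - 1)
        + 2 * ((4 ^ m - 1) / 3) * (8 * (8 ^ s - 1)) / 7
        + 4 / 7 * threeCount m * (8 ^ s - 1)
        + 4 ^ (s + 1) * (3 * 8 ^ m + 4) / 7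
        + survivorCount (s + 1) + (4 * ((4 ^ m - 1) / 3) + threeCount m) * survivorCount s := by
  obtain ⟨h0, h1, h2, h3, h4⟩ := highCount_closed s
  obtain ⟨k0, k1, k2, k3, k4⟩ := highCount_closed (s + 1)
  have k5 : highCount (s + 1) 5 = 6 * 8 ^ s + 2 * ((3 * 8 ^ s + 4) / 7) := by
    simp [highCount_succ, highTrans, Fin.sum_univ_succ, h0, h1, h2, h3, h4]
  have k6 : highCount (s + 1) 6 =
      4 * 8 ^ s + 2 * (8 ^ s - 4 ^ s) + 2 * (3 / 7 * 8 ^ s - 4 ^ s / 3 - 2 / 21) := by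
    simp [highCount_succ, highTrans, Fin.sum_univ_succ, h0, h1, h2, h3, h4]
    ring
  have k7 : highCount (s + 1) 7 = 7 * 8 ^ s + (3 * 8 ^ s + 4) / 7 := by
    simp [highCount_succ, highTrans, Fin.sum_univ_succ, h0, h1, h2, h3, h4]
  have k8 : highCount (s + 1) 8 =
      4 * 8 ^ s + 3 * (8 ^ s - 4 ^ s) + (3 / 7 * 8 ^ s - 4 ^ s / 3 - 2 / 21) := by
    simp [highCount_succ, highTrans, Fin.sum_univ_succ, h0, h1, h2, h3, h4]
    ring
  rw [numImpossibleXR_eq hm, lowTrans_pow, Fintype.sum_bool, Fin.sum_univ_seven, Fin.sum_univ_seven]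
  simp only [liftClass]
  simp [k0, k1, k2, k3, k4, k5, k6, k7, k8, threeCount, survivorCount]
  ring

theorem threeCount_nonneg (m : ℕ) : 0 ≤ threeCount m := by
  induction m with
  | zero => norm_num [threeCount]
  | succ m ih =>
    have h8 : (1 : ℚ) ≤ 8 ^ m := one_le_pow₀ (by norm_num)
    have h4 : (1 : ℚ) ≤ 4 ^ m := one_le_pow₀ (by norm_num)
    have h : threeCount (m + 1) = 3 * threeCount m + 3 / 7 * 8 ^ m + 4 ^ m / 3 - 16 / 21 := by
      simp only [threeCount]
      ring
    linarith

/-! ### Bounds -/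

theorem pow_four (s : ℕ) : (4 : ℚ) ^ s = (2 ^ s) ^ 2 := by
  rw [← pow_mul, mul_comm, pow_mul]; norm_num

theorem pow_eight (s : ℕ) : (8 : ℚ) ^ s = (2 ^ s) ^ 3 := by
  rw [← pow_mul, mul_comm, pow_mul]; norm_num

theorem survivorCount_nonneg (s : ℕ) : 0 ≤ survivorCount s := by
  have h : (1 : ℚ) ≤ 2 ^ s := one_le_pow₀ (by norm_num)
  rw [survivorCount, pow_four, pow_eight]
  nlinarith [mul_nonneg (sub_nonneg.2 h) (sub_nonneg.2 (one_le_pow₀ (n := 2) h)),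
    sq_nonneg ((2 : ℚ) ^ s - 1)]

end Carry

open Carry

theorem numImpossibleXR_le {m s : ℕ} (hm : 2 ≤ m) (hs : 1 ≤ s) :
    (numImpossibleXR (m + (s + 1)) (s + 1) : ℚ) ≤
      (1 / 7 + 1 / 2 ^ (s + 1 + 1)) * 8 ^ (m + (s + 1)) - 1 / 7 * 8 ^ (s + 1)
        + 4 / 7 * (8 ^ s - 1) * (1 / 5 * 8 ^ m + 7 * 4 ^ m - 124 / 5 * 3 ^ (m - 2)) := by
  rw [numImpossibleXR_closed (by omega)]
  have hp : (2 : ℚ) ≤ 2 ^ s := le_self_pow₀ (by norm_num) (by omega)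
  have hX : survivorCount s ≤ 4 / 7 * (8 ^ s - 1) := by
    rw [survivorCount, pow_four, pow_eight]
    nlinarith
  have h3 : (3 : ℚ) ^ (m - 2) = 3 ^ m / 9 := by
    obtain ⟨k, rfl⟩ := Nat.exists_eq_add_of_le hm
    rw [Nat.add_sub_cancel_left, pow_add]
    ring
  have h34 : (3 : ℚ) ^ m ≤ 4 ^ m := pow_le_pow_left₀ (by norm_num) (by norm_num) m
  have h4 : (16 : ℚ) ≤ 4 ^ m := by
    calc (16 : ℚ) = 4 ^ 2 := by norm_num
      _ ≤ 4 ^ m := pow_le_pow_right₀ (by norm_num) hm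
  have h8 : (64 : ℚ) ≤ 8 ^ m := by
    calc (64 : ℚ) = 8 ^ 2 := by norm_num
      _ ≤ 8 ^ m := pow_le_pow_right₀ (by norm_num) hm
  have ht : (7 : ℚ) ≤ 8 ^ s - 1 := by
    rw [pow_eight]
    nlinarith [mul_nonneg (sub_nonneg.2 hp) (sub_nonneg.2 hp)]
  -- All terms with a factor `8 ^ s - 1` are collected in `hZ`; the `- 4` leaves a multiple of
  -- `8 ^ s - 1` that pays for the remaining terms.
  have hY : (4 * ((4 ^ m - 1) / 3) + threeCount m) * survivorCount s ≤
      (4 * ((4 ^ m - 1) / 3) + threeCount m) * (4 / 7 * (8 ^ s - 1)) :=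
    mul_le_mul_of_nonneg_left hX (by linarith [threeCount_nonneg m])
  have hZ : 0 ≤ (8 ^ s - 1) * (1 / 5 * 8 ^ m + 7 * 4 ^ m - 124 / 5 * (3 ^ m / 9)
      - 8 * ((4 ^ m - 1) / 3) - 2 * threeCount m - (4 : ℚ)) := by
    refine mul_nonneg (by linarith) ?_
    rw [threeCount]
    linarith
  have hW : (0 : ℚ) ≤ 4 ^ s * (8 ^ m - 8) := mul_nonneg (by positivity) (by linarith)
  have hD : (1 : ℚ) / 2 ^ (s + 1 + 1) * 8 ^ (m + (s + 1)) = 2 * 4 ^ s * 8 ^ m := by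
    rw [pow_add 8 m, pow_succ 8 s, pow_eight s, pow_four s, pow_succ, pow_succ]
    field_simp
    ring
  have hX1 : survivorCount (s + 1) ≤ 4 / 7 * 8 ^ (s + 1) := by
    have : (1 : ℚ) ≤ 4 ^ s := one_le_pow₀ (by norm_num)
    rw [survivorCount, pow_succ, pow_succ]
    linarith
  rw [add_mul (1 / 7 : ℚ), hD, h3, pow_add 8 m, pow_succ 8 s, pow_succ 4 s]
  rw [pow_succ 8 s] at hX1
  linarith

theorem numImpossibleXR_pred_le (s : ℕ) :
    (numImpossibleXR (1 + (s + 1)) (s + 1) : ℚ) ≤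
      (9 / 28 + 1 / 2 ^ (1 + (s + 1))) * 8 ^ (1 + (s + 1)) - 88 / 7 := by
  have hD : (1 : ℚ) / 2 ^ (1 + (s + 1)) * 8 ^ (1 + (s + 1)) = 16 * 4 ^ s := by
    rw [pow_add 8, pow_add 2, pow_succ 8 s, pow_succ 2 s, pow_eight s, pow_four s]
    field_simp
    ring
  have h8 : (1 : ℚ) ≤ 8 ^ s := one_le_pow₀ (by norm_num)
  have h4 : (1 : ℚ) ≤ 4 ^ s := one_le_pow₀ (by norm_num)
  rw [numImpossibleXR_closed one_pos, add_mul (9 / 28 : ℚ), hD]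
  have hU : threeCount 1 = 0 := by norm_num [threeCount]
  rw [hU, survivorCount, survivorCount, pow_add (8 : ℚ) 1 (s + 1), pow_succ (8 : ℚ) s,
    pow_succ (4 : ℚ) s]
  linarith

theorem le_numImpossibleXR {m : ℕ} (hm : 0 < m) (s : ℕ) :
    1 / 7 * 8 ^ (m + (s + 1)) - 1 / 7 * 8 ^ (s + 1) ≤
      (numImpossibleXR (m + (s + 1)) (s + 1) : ℚ) := by
  have h8 : (1 : ℚ) ≤ 8 ^ s := one_le_pow₀ (by norm_num)
  have h4 : (1 : ℚ) ≤ 4 ^ s := one_le_pow₀ (by norm_num)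
  have h4m : (1 : ℚ) ≤ 4 ^ m := one_le_pow₀ (by norm_num)
  have hU := threeCount_nonneg m
  have hF : (0 : ℚ) ≤ (4 ^ m - 1) / 3 := by linarith
  have h1 : (0 : ℚ) ≤ 2 * ((4 ^ m - 1) / 3) * (8 * (8 ^ s - 1)) / 7 :=
    div_nonneg (mul_nonneg (by linarith) (by linarith)) (by norm_num)
  have h2 : (0 : ℚ) ≤ 4 / 7 * threeCount m * (8 ^ s - 1) := mul_nonneg (by linarith) (by linarith)
  have h3 : (4 : ℚ) ^ s ≤ 4 ^ s * 8 ^ m :=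
    le_mul_of_one_le_right (by positivity) (one_le_pow₀ (by norm_num))
  have h5 : 0 ≤ (4 * ((4 ^ m - 1) / 3) + threeCount m) * survivorCount s :=
    mul_nonneg (by linarith) (survivorCount_nonneg s)
  have h6 : survivorCount (s + 1) = 32 / 7 * 8 ^ s - 8 / 3 * 4 ^ s + 2 / 21 := by
    rw [survivorCount]; ring
  rw [numImpossibleXR_closed hm, pow_add 8 m, pow_succ 8 s, pow_succ 4 s]
  linarith

theorem mainTheorem2 :
    (∀ n r : ℕ, 2 ≤ r → r + 2 ≤ n →
      (numImpossibleXR n r : ℚ) ≤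
        (1 / 7 + 1 / 2 ^ (r + 1)) * 8 ^ n - 1 / 7 * 8 ^ r
          + 4 / 7 * (8 ^ (r - 1) - 1)
            * (1 / 5 * 8 ^ (n - r) + 7 * 4 ^ (n - r) - 124 / 5 * 3 ^ (n - r - 2))) ∧
    (∀ n : ℕ, 2 ≤ n →
      (numImpossibleXR n (n - 1) : ℚ) ≤ (9 / 28 + 1 / 2 ^ n) * 8 ^ n - 88 / 7) ∧
    (∀ n r : ℕ, 1 ≤ r → r + 1 ≤ n →
      (numImpossibleXR n r : ℚ) ≥ 1 / 7 * 8 ^ n - 1 / 7 * 8 ^ r) ∧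
    (∀ n : ℕ, 2 ≤ n →
      (numImpossibleXR n 1 : ℚ) = 5 / 14 * 8 ^ n - 6 / 7) := by
  refine ⟨fun n r hr hn => ?_, fun n hn => ?_, fun n r hr hn => ?_, fun n hn => ?_⟩
  · obtain ⟨s, rfl⟩ := Nat.exists_eq_add_of_le' (show 1 ≤ r by omega)
    obtain ⟨m, rfl⟩ := Nat.exists_eq_add_of_le' (show s + 1 ≤ n by omega)
    rw [Nat.add_sub_cancel, Nat.add_sub_cancel]
    exact numImpossibleXR_le (by omega) (by omega)
  · obtain ⟨s, rfl⟩ := Nat.exists_eq_add_of_le hn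
    rw [show 2 + s = 1 + (s + 1) by omega, Nat.add_sub_cancel_left]
    exact numImpossibleXR_pred_le s
  · obtain ⟨s, rfl⟩ := Nat.exists_eq_add_of_le' hr
    obtain ⟨m, rfl⟩ := Nat.exists_eq_add_of_le' (show s + 1 ≤ n by omega)
    exact le_numImpossibleXR (by omega) s
  · obtain ⟨m, rfl⟩ := Nat.exists_eq_add_of_le' (show 0 + 1 ≤ n by omega)
    have h := numImpossibleXR_closed (m := m) (by omega) 0
    rw [h]
    norm_num [survivorCount, pow_succ]
    ring
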